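/- All graphs are finite, simple, undirected and connected. Let $\rho(G)$ denote the largest eigenvalue of the adjacency matrix of $G$, let $i(G)$ be the number of isolated vertices of $G$, and let $G-S$ be obtained from $G$ by deleting the vertices of $S\subseteq V(G)$. For disjoint graphs, $G_1+G_2$ is the disjoint union, $G_1\vee G_2$ is the join (the disjoint union together with all edges between $G_1$ and $G_2$), and $mK_1$ is the edgeless graph on $m$ vertices. For an even integer $k\ge 2$, a $k$-barrier of $G$ is a set $S\subseteq V(G)$ at which $k\cdot i(G-S)-k|S|$ attains its maximum over all subsets of $V(G)$ (for odd $k$, the number of components of $G-S$ that have odd order greater than $1$ is added to this quantity). A graph of odd (respectively even) order is $\mathrm{GFC}_k$ (respectively $\mathrm{GBC}_k$) if $\emptyset$ is its only $k$-barrier. **Theorem 6.2.** Let $n\ge 3$, let $k\ge 2$ be even, and let $G$ be a connected graph of order $n$. (1) If $n\ge 7$ or $n\in\{3,5\}$, and $\rho(G)\ge\rho(K_1\vee(K_{n-2}+K_1))$, then $G$ is $\mathrm{GFC}_k$ (when $n$ is odd), respectively $\mathrm{GBC}_k$ (when $n$ is even), unless $G\cong K_1\vee(K_{n-2}+K_1)$,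 in which case it is not. (2) If $n\in\{4,6\}$ and $\rho(G)\ge\rho(K_{n/2}\vee\frac n2K_1)$, then $G$ is $\mathrm{GBC}_k$ unless $G\cong K_{n/2}\vee\frac n2K_1$, in which case it is not. -/

import Mathlib

/-- The join `G ∨ H`: the disjoint union of `G` and `H` together with all edges between them. -/
def graphJoin {V W : Type*} (G : SimpleGraph V) (H : SimpleGraph W) : SimpleGraph (V ⊕ W) :=
  (G ⊕g H) ⊔ completeBipartiteGraph V W

theorem graphJoin_adj_inl {V W : Type*} (G : SimpleGraph V) (H : SimpleGraph W) (a b : V) :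
    (graphJoin G H).Adj (Sum.inl a) (Sum.inl b) ↔ G.Adj a b := by
  simp [graphJoin]

theorem graphJoin_adj_inr {V W : Type*} (G : SimpleGraph V) (H : SimpleGraph W) (a b : W) :
    (graphJoin G H).Adj (Sum.inr a) (Sum.inr b) ↔ H.Adj a b := by
  simp [graphJoin]

theorem graphJoin_adj_inl_inr {V W : Type*} (G : SimpleGraph V) (H : SimpleGraph W)
    (a : V) (b : W) : (graphJoin G H).Adj (Sum.inl a) (Sum.inr b) := by
  simp [graphJoin]

open Classical in
/-- The adjacency spectral radius `ρ(G)`: the largest eigenvalue of the adjacency matrix of `G`. -/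
noncomputable def adjSpectralRadius {V : Type*} [Fintype V] (G : SimpleGraph V) : ℝ :=
  sSup (spectrum ℝ (G.adjMatrix ℝ))

open Classical in
/-- On a nonempty vertex set the supremum is attained: `ρ(G)` is the greatest eigenvalue. -/
theorem isGreatest_adjSpectralRadius {V : Type*} [Fintype V] [Nonempty V] (G : SimpleGraph V) :
    IsGreatest (spectrum ℝ (G.adjMatrix ℝ)) (adjSpectralRadius G) := by
  have h := (G.isHermitian_adjMatrix ℝ).spectrum_real_eq_range_eigenvalues
  have hfin : (spectrum ℝ (G.adjMatrix ℝ)).Finite := h ▸ Set.finite_range _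
  have hne : (spectrum ℝ (G.adjMatrix ℝ)).Nonempty := h ▸ Set.range_nonempty _
  exact ⟨hne.csSup_mem hfin, fun x hx => le_csSup hfin.bddAbove hx⟩

/-- `G - S`: the graph obtained from `G` by deleting the vertices in `S`. -/
abbrev deleteVertices {V : Type*} (G : SimpleGraph V) (S : Set V) :
    SimpleGraph (Sᶜ : Set V) :=
  G.induce Sᶜ

/-- `i(G)`: the number of isolated vertices of `G`. -/
noncomputable def isolatedCount {V : Type*} (G : SimpleGraph V) : ℕ :=
  {v : V | G.IsIsolated v}.ncard

/-- `odd(G)`: the number of nontrivial components of `G` (those with more than one vertex)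
of odd order. -/
noncomputable def oddNontrivialCount {V : Type*} (G : SimpleGraph V) : ℕ :=
  {c : G.ConnectedComponent | Odd c.supp.ncard ∧ 1 < c.supp.ncard}.ncard

/-- The quantity maximized over `S ⊆ V(G)` in the `k`-Berge-Tutte formula:
`k·i(G-S) - k|S|` for even `k`, and `odd(G-S) + k·i(G-S) - k|S|` for odd `k`. -/
noncomputable def bergeTutteValue {V : Type*} (k : ℕ) (G : SimpleGraph V) (S : Set V) : ℤ :=
  if Even k then
    (k : ℤ) * (isolatedCount (deleteVertices G S) : ℤ) - (k : ℤ) * (S.ncard : ℤ)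
  else
    (oddNontrivialCount (deleteVertices G S) : ℤ)
      + (k : ℤ) * (isolatedCount (deleteVertices G S) : ℤ) - (k : ℤ) * (S.ncard : ℤ)

/-- `S` is a `k`-barrier of `G`: it attains the maximum in the `k`-Berge-Tutte formula. -/
def IsKBarrier {V : Type*} (k : ℕ) (G : SimpleGraph V) (S : Set V) : Prop :=
  ∀ T : Set V, bergeTutteValue k G T ≤ bergeTutteValue k G S

/-- `G` is `GFC_k` (generalized factor-critical): it has odd order and `∅` is its only
`k`-barrier. -/
def IsGFC {V : Type*} (k : ℕ) (G : SimpleGraph V) : Prop :=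
  Odd (Nat.card V) ∧ ∀ S : Set V, IsKBarrier k G S ↔ S = ∅

/-- `G` is `GBC_k` (generalized bicritical): it has even order and `∅` is its only
`k`-barrier. -/
def IsGBC {V : Type*} (k : ℕ) (G : SimpleGraph V) : Prop :=
  Even (Nat.card V) ∧ ∀ S : Set V, IsKBarrier k G S ↔ S = ∅

/-- The graph `K_1 ∨ (K_{n-2} + K_1)`, of order `n` for `n ≥ 2`. -/
def pendantCliqueGraph (n : ℕ) : SimpleGraph (Fin 1 ⊕ (Fin (n - 2) ⊕ Fin 1)) :=
  graphJoin (⊤ : SimpleGraph (Fin 1))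
    ((⊤ : SimpleGraph (Fin (n - 2))) ⊕g (⊤ : SimpleGraph (Fin 1)))

/-- The graph `K_{n/2} ∨ (n/2)K_1`, of order `n` for even `n`; `m K_1` is the edgeless graph
on `m` vertices. -/
def halfSplitGraph (n : ℕ) : SimpleGraph (Fin (n / 2) ⊕ Fin (n / 2)) :=
  graphJoin (⊤ : SimpleGraph (Fin (n / 2))) (⊥ : SimpleGraph (Fin (n / 2)))

/-! For even `k` the barrier value is `k (i(G-S) - |S|)`, which is `0` at `∅`. So `∅` fails to be
the only barrier exactly when some nonempty `S` has `s = |S|` vertices `I` isolated in `G - S`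
(`forall_isKBarrier_iff_eq_empty`). Then `G` is a spanning subgraph of `K_s ∨ (K_t + sK_1)` with `n
= 2s + t`.

If this supergraph is the extremal graph (`s = 1`, or `t = 0` for `n = 4, 6`), strict monotonicity
of `ρ` under adding edges to a connected graph forces equality. Otherwise a test vector constant on
`S`, `I` and the rest bounds `ρ(G)` by a number strictly below the extremal radius: `n - 2` in
general, `5/2` for `n = 4` and `41/10` for `n = 6`. -/

/-! ### Rayleigh and test-vector bounds, strict monotonicity of the spectral radius. -/

section SpectralRadius

open scoped Classical Matrix

variable {V W : Type*} [Fintype V] [Fintype W]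

theorem adjSpectralRadius_congr {G : SimpleGraph V} {H : SimpleGraph W} (e : G ≃g H) :
    adjSpectralRadius G = adjSpectralRadius H := by
  unfold adjSpectralRadius
  have h : G.adjMatrix ℝ = Matrix.reindexAlgEquiv ℝ ℝ e.symm.toEquiv (H.adjMatrix ℝ) := by
    ext u v
    simp only [Matrix.coe_reindexAlgEquiv, Matrix.reindex_apply, Matrix.submatrix_apply,
      SimpleGraph.adjMatrix_apply]
    exact if_congr e.map_adj_iff.symm rfl rfl
  rw [h, AlgEquiv.spectrum_eq]

theorem exists_adjSpectralRadius_eigenvector [Nonempty V] (G : SimpleGraph V) :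
    ∃ x : V → ℝ, x ≠ 0 ∧ G.adjMatrix ℝ *ᵥ x = adjSpectralRadius G • x := by
  have h := (isGreatest_adjSpectralRadius G).1
  rw [← Matrix.spectrum_toLin', ← Module.End.hasEigenvalue_iff_mem_spectrum] at h
  obtain ⟨x, hx⟩ := h.exists_hasEigenvector
  exact ⟨x, hx.2, by simpa using hx.apply_eq_smul⟩

theorem posSemidef_adjSpectralRadius_sub [Nonempty V] (G : SimpleGraph V) :
    (algebraMap ℝ (Matrix V V ℝ) (adjSpectralRadius G) - G.adjMatrix ℝ).PosSemidef := by
  rw [Matrix.posSemidef_iff_isHermitian_and_spectrum_nonneg]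
  refine ⟨Matrix.IsHermitian.sub ?_ (G.isHermitian_adjMatrix ℝ), ?_⟩
  · rw [Algebra.algebraMap_eq_smul_one]
    simp [Matrix.IsHermitian]
  · rw [← spectrum.singleton_sub_eq]
    rintro _ ⟨_, rfl, y, hy, rfl⟩
    exact sub_nonneg.2 ((isGreatest_adjSpectralRadius G).2 hy)

theorem dotProduct_adjSpectralRadius_sub_mulVec (G : SimpleGraph V) (x : V → ℝ) :
    x ⬝ᵥ ((algebraMap ℝ (Matrix V V ℝ) (adjSpectralRadius G) - G.adjMatrix ℝ) *ᵥ x) =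
      adjSpectralRadius G * (x ⬝ᵥ x) - x ⬝ᵥ (G.adjMatrix ℝ *ᵥ x) := by
  simp [Matrix.sub_mulVec, Algebra.algebraMap_eq_smul_one, Matrix.smul_mulVec, dotProduct_sub]

/-- The Rayleigh bound. -/
theorem dotProduct_adjMatrix_mulVec_le [Nonempty V] (G : SimpleGraph V) (x : V → ℝ) :
    x ⬝ᵥ (G.adjMatrix ℝ *ᵥ x) ≤ adjSpectralRadius G * (x ⬝ᵥ x) := by
  have h := (posSemidef_adjSpectralRadius_sub G).dotProduct_mulVec_nonneg x
  rw [star_trivial, dotProduct_adjSpectralRadius_sub_mulVec] at h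
  linarith

/-- Equality in the Rayleigh bound puts `x` in the kernel of the positive semidefinite matrix `ρI -
A`. -/
theorem adjMatrix_mulVec_eq_of_dotProduct_eq [Nonempty V] (G : SimpleGraph V) (x : V → ℝ)
    (hx : x ⬝ᵥ (G.adjMatrix ℝ *ᵥ x) = adjSpectralRadius G * (x ⬝ᵥ x)) :
    G.adjMatrix ℝ *ᵥ x = adjSpectralRadius G • x := by
  have h := ((posSemidef_adjSpectralRadius_sub G).dotProduct_mulVec_zero_iff x).1 (by
    rw [star_trivial, dotProduct_adjSpectralRadius_sub_mulVec, hx, sub_self])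
  rw [Matrix.sub_mulVec, Algebra.algebraMap_eq_smul_one, Matrix.smul_mulVec, Matrix.one_mulVec,
    sub_eq_zero] at h
  exact h.symm

theorem abs_adjMatrix_mulVec_le (G : SimpleGraph V) (x : V → ℝ) (v : V) :
    |(G.adjMatrix ℝ *ᵥ x) v| ≤ (G.adjMatrix ℝ *ᵥ |x|) v := by
  simp only [SimpleGraph.adjMatrix_mulVec_apply, Pi.abs_apply]
  exact Finset.abs_sum_le_sum_abs _ _

/-- Pair `z` with `|x|`, where `x` is an eigenvector for `ρ`: by symmetry of `A`, `ρ z·|x| ≤ z·A|x|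
= Az·|x| ≤ r z·|x|`, and `z·|x| > 0`. -/
theorem adjSpectralRadius_le_of_mulVec_le [Nonempty V] (G : SimpleGraph V) (z : V → ℝ) (r : ℝ)
    (hz : ∀ v, 0 < z v) (h : ∀ v, (G.adjMatrix ℝ *ᵥ z) v ≤ r * z v) :
    adjSpectralRadius G ≤ r := by
  obtain ⟨x, hx0, hx⟩ := exists_adjSpectralRadius_eigenvector G
  obtain ⟨w, hw⟩ := Function.ne_iff.1 hx0
  have hpos : 0 < z ⬝ᵥ |x| :=
    Finset.sum_pos' (fun v _ => mul_nonneg (hz v).le (abs_nonneg _))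
      ⟨w, Finset.mem_univ _, mul_pos (hz w) (abs_pos.2 hw)⟩
  have h1 : adjSpectralRadius G * (z ⬝ᵥ |x|) ≤ z ⬝ᵥ (G.adjMatrix ℝ *ᵥ |x|) := by
    rw [dotProduct, dotProduct, Finset.mul_sum]
    refine Finset.sum_le_sum fun v _ => ?_
    have h2 := abs_adjMatrix_mulVec_le G x v
    rw [hx, Pi.smul_apply, smul_eq_mul, abs_mul] at h2
    have h3 : adjSpectralRadius G * |x v| ≤ (G.adjMatrix ℝ *ᵥ |x|) v :=
      (mul_le_mul_of_nonneg_right (le_abs_self _) (abs_nonneg _)).trans h2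
    calc _ = z v * (adjSpectralRadius G * |x v|) := by simp only [Pi.abs_apply]; ring
      _ ≤ _ := mul_le_mul_of_nonneg_left h3 (hz v).le
  have h4 : z ⬝ᵥ (G.adjMatrix ℝ *ᵥ |x|) ≤ r * (z ⬝ᵥ |x|) := by
    rw [Matrix.dotProduct_mulVec, ← Matrix.mulVec_transpose, SimpleGraph.transpose_adjMatrix,
      dotProduct, dotProduct, Finset.mul_sum]
    refine Finset.sum_le_sum fun v _ => ?_
    rw [← mul_assoc]
    exact mul_le_mul_of_nonneg_right (h v) (abs_nonneg _)
  exact le_of_mul_le_mul_right (h1.trans h4) hpos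

theorem lt_adjSpectralRadius_of_le_mulVec (G : SimpleGraph V) (z : V → ℝ) (r : ℝ)
    (hz : ∀ v, 0 ≤ z v) (h : ∀ v, r * z v ≤ (G.adjMatrix ℝ *ᵥ z) v) (w : V) (hw : 0 < z w)
    (hlt : r * z w < (G.adjMatrix ℝ *ᵥ z) w) : r < adjSpectralRadius G := by
  have : Nonempty V := ⟨w⟩
  have hpos : 0 < z ⬝ᵥ z :=
    Finset.sum_pos' (fun v _ => mul_nonneg (hz v) (hz v)) ⟨w, Finset.mem_univ _, mul_pos hw hw⟩
  have h1 : r * (z ⬝ᵥ z) < z ⬝ᵥ (G.adjMatrix ℝ *ᵥ z) := by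
    rw [dotProduct, dotProduct, Finset.mul_sum]
    refine Finset.sum_lt_sum (fun v _ => ?_) ⟨w, Finset.mem_univ _, ?_⟩
    · rw [mul_left_comm]
      exact mul_le_mul_of_nonneg_left (h v) (hz v)
    · rw [mul_left_comm]
      exact mul_lt_mul_of_pos_left hlt hw
  exact lt_of_mul_lt_mul_right (h1.trans_le (dotProduct_adjMatrix_mulVec_le G z)) hpos.le

/-- At a zero of `y` the nonnegative values on the neighbours sum to zero, so zeros spread along
walks. -/
theorem pos_of_adjMatrix_mulVec_eq {G : SimpleGraph V} (hG : G.Connected) {y : V → ℝ} {r : ℝ}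
    (hy : ∀ v, 0 ≤ y v) (hy0 : y ≠ 0) (h : G.adjMatrix ℝ *ᵥ y = r • y) (v : V) : 0 < y v := by
  refine lt_of_le_of_ne (hy v) fun hv => hy0 ?_
  have key : ∀ a b, G.Reachable a b → y a = 0 → y b = 0 := by
    rintro a b ⟨p⟩ ha
    induction p with
    | nil => exact ha
    | @cons u w _ huw _ ih =>
      apply ih
      have h1 := congrFun h u
      rw [SimpleGraph.adjMatrix_mulVec_apply, Pi.smul_apply, ha, smul_zero,
        Finset.sum_eq_zero_iff_of_nonneg fun i _ => hy i] at h1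
      exact h1 w (by simpa using huw)
  ext w
  exact key v w (hG.preconnected v w) hv.symm

/-- Strict monotonicity of the spectral radius: a connected graph has a smaller spectral radius
than any proper spanning supergraph. -/
theorem eq_of_le_of_adjSpectralRadius_le {G H : SimpleGraph V} (hG : G.Connected) (hGH : G ≤ H)
    (hρ : adjSpectralRadius H ≤ adjSpectralRadius G) : G = H := by
  have := hG.nonempty
  obtain ⟨x, hx0, hx⟩ := exists_adjSpectralRadius_eigenvector G
  set y : V → ℝ := |x| with hy
  have hynn : ∀ v, 0 ≤ y v := fun v => abs_nonneg _
  have hy0 : y ≠ 0 := by simpa [hy] using hx0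
  have hmono : ∀ v, (G.adjMatrix ℝ *ᵥ y) v ≤ (H.adjMatrix ℝ *ᵥ y) v := fun v => by
    simp only [SimpleGraph.adjMatrix_mulVec_apply]
    refine Finset.sum_le_sum_of_subset_of_nonneg (fun u hu => ?_) fun i _ _ => hynn i
    rw [SimpleGraph.mem_neighborFinset] at hu ⊢
    exact hGH hu
  have h1 : adjSpectralRadius G * (y ⬝ᵥ y) ≤ y ⬝ᵥ (G.adjMatrix ℝ *ᵥ y) := by
    rw [dotProduct, dotProduct, Finset.mul_sum]
    refine Finset.sum_le_sum fun v _ => ?_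
    have h2 := abs_adjMatrix_mulVec_le G x v
    rw [hx, Pi.smul_apply, smul_eq_mul, abs_mul] at h2
    rw [mul_left_comm]
    exact mul_le_mul_of_nonneg_left
      ((mul_le_mul_of_nonneg_right (le_abs_self _) (abs_nonneg _)).trans h2) (hynn v)
  have h2 : y ⬝ᵥ (G.adjMatrix ℝ *ᵥ y) ≤ y ⬝ᵥ (H.adjMatrix ℝ *ᵥ y) :=
    Finset.sum_le_sum fun v _ => mul_le_mul_of_nonneg_left (hmono v) (hynn v)
  have h3 := dotProduct_adjMatrix_mulVec_le H y
  have h4 := dotProduct_adjMatrix_mulVec_le G y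
  have h5 : adjSpectralRadius H * (y ⬝ᵥ y) ≤ adjSpectralRadius G * (y ⬝ᵥ y) :=
    mul_le_mul_of_nonneg_right hρ (Finset.sum_nonneg fun v _ => mul_nonneg (hynn v) (hynn v))
  -- The chain `ρ(G) y·y ≤ y·A_G y ≤ y·A_H y ≤ ρ(H) y·y ≤ ρ(G) y·y` collapses to equalities.
  have hGy := adjMatrix_mulVec_eq_of_dotProduct_eq G y (by linarith)
  have hpos := pos_of_adjMatrix_mulVec_eq hG hynn hy0 hGy
  have hsum : ∀ v, (G.adjMatrix ℝ *ᵥ y) v = (H.adjMatrix ℝ *ᵥ y) v := by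
    have h6 : y ⬝ᵥ (G.adjMatrix ℝ *ᵥ y) = y ⬝ᵥ (H.adjMatrix ℝ *ᵥ y) := by linarith
    intro v
    have h7 := (Finset.sum_eq_sum_iff_of_le fun v _ =>
      mul_le_mul_of_nonneg_left (hmono v) (hynn v)).1 h6 v (Finset.mem_univ v)
    exact mul_left_cancel₀ (hpos v).ne' h7
  refine le_antisymm hGH fun u v huv => ?_
  by_contra hn
  -- An extra edge `uv` of `H` would add `y v > 0` to the sum at `u`.
  refine (hsum u).not_lt ?_
  simp only [SimpleGraph.adjMatrix_mulVec_apply]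
  refine Finset.sum_lt_sum_of_subset (i := v) (fun w hw => ?_) (by simpa using huv)
    (by simpa using hn) (hpos v) fun i _ _ => hynn i
  rw [SimpleGraph.mem_neighborFinset] at hw ⊢
  exact hGH hw

end SpectralRadius

/-! ### Barriers and isolating pairs. -/

section Barriers

variable {V : Type*}

/-- `S` is nonempty, and `I` consists of as many vertices as `S`, all isolated in `G - S`. -/
def IsIsolatingPair (G : SimpleGraph V) (S I : Finset V) : Prop :=
  S.Nonempty ∧ I.card = S.card ∧ Disjoint S I ∧ ∀ v ∈ I, ∀ w, G.Adj v w → w ∈ S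

theorem isolatedCount_deleteVertices (G : SimpleGraph V) (S : Set V) :
    isolatedCount (deleteVertices G S) = {v | v ∉ S ∧ ∀ w, G.Adj v w → w ∈ S}.ncard := by
  rw [isolatedCount, ← Set.ncard_image_of_injective _ Subtype.val_injective]
  congr 1
  ext v
  simp only [Set.mem_image, Set.mem_ofPred_eq, SimpleGraph.IsIsolated, Subtype.exists,
    exists_and_right, exists_eq_right, Subtype.forall, SimpleGraph.comap_adj,
    Function.Embedding.subtype_apply, Set.mem_compl_iff]
  exact ⟨fun ⟨hv, h⟩ => ⟨hv, fun w hw => by_contra fun hwS => h w hwS hw⟩,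
    fun ⟨hv, h⟩ => ⟨hv, fun w hwS hw => hwS (h w hw)⟩⟩

theorem forall_isKBarrier_iff_eq_empty [Fintype V] [Nontrivial V] {G : SimpleGraph V}
    (hG : G.Connected) {k : ℕ} (hk : Even k) (hk0 : 0 < k) :
    (∀ S : Set V, IsKBarrier k G S ↔ S = ∅) ↔ ¬ ∃ S I : Finset V, IsIsolatingPair G S I := by
  classical
  have hval : ∀ S : Set V, bergeTutteValue k G S =
      k * (({v | v ∉ S ∧ ∀ w, G.Adj v w → w ∈ S}.ncard : ℤ) - S.ncard) := fun S => by
    rw [bergeTutteValue, if_pos hk, isolatedCount_deleteVertices, mul_sub]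
  have hempty : bergeTutteValue k G ∅ = 0 := by
    have : {v | v ∉ (∅ : Set V) ∧ ∀ w, G.Adj v w → w ∈ (∅ : Set V)} = ∅ := by
      rw [Set.eq_empty_iff_forall_notMem]
      rintro v ⟨-, hv⟩
      -- This is where at least two vertices are needed: a single vertex would be isolated.
      obtain ⟨w, hw⟩ := hG.preconnected.exists_adj_of_nontrivial v
      exact hv w hw
    rw [hval, this]
    simp
  have hk0' : (0 : ℤ) < k := by exact_mod_cast hk0
  constructor
  · rintro h ⟨S, I, hS, hcard, hdisj, hI⟩
    have hle : S.card ≤ {v | v ∉ (S : Set V) ∧ ∀ w, G.Adj v w → w ∈ (S : Set V)}.ncard := by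
      rw [← hcard, ← Set.ncard_coe_finset]
      refine Set.ncard_le_ncard (fun v hv => ⟨fun hvS => ?_, fun w hw => hI v hv w hw⟩)
      exact Finset.disjoint_left.1 hdisj hvS hv
    have hnn : 0 ≤ bergeTutteValue k G S := by
      rw [hval, Set.ncard_coe_finset]
      exact mul_nonneg hk0'.le (by omega)
    have := (h S).1 fun T => ((h ∅).2 rfl T).trans (hempty.trans_le hnn)
    exact hS.ne_empty (by exact_mod_cast this)
  · intro h
    have hneg : ∀ S : Set V, S.Nonempty → bergeTutteValue k G S < 0 := by
      intro S hS
      rw [hval]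
      refine mul_neg_of_pos_of_neg hk0' ?_
      by_contra hcon
      obtain ⟨I, hIsub, hIcard⟩ := Set.exists_subset_card_eq (n := S.ncard)
        (s := {v | v ∉ S ∧ ∀ w, G.Adj v w → w ∈ S}) (by omega)
      refine h ⟨S.toFinset, I.toFinset, by simpa using hS, ?_, ?_, ?_⟩
      · rw [← Set.ncard_eq_toFinset_card', ← Set.ncard_eq_toFinset_card', hIcard]
      · rw [Set.disjoint_toFinset, Set.disjoint_right]
        exact fun v hv => (hIsub hv).1
      · intro v hv w hw
        rw [Set.mem_toFinset] at hv ⊢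
        exact (hIsub hv).2 w hw
    intro S
    constructor
    · intro hS
      by_contra hne
      have := hS ∅
      have := hneg S (Set.nonempty_iff_ne_empty.2 hne)
      omega
    · rintro rfl T
      rcases T.eq_empty_or_nonempty with rfl | hT
      · exact le_rfl
      · rw [hempty]
        exact (hneg T hT).le

theorem IsIsolatingPair.map {W : Type*} {G : SimpleGraph V} {H : SimpleGraph W} {S I : Finset V}
    (h : IsIsolatingPair G S I) (e : G ≃g H) :
    IsIsolatingPair H (S.map e.toEquiv.toEmbedding) (I.map e.toEquiv.toEmbedding) := by
  obtain ⟨hS, hc, hd, hI⟩ := h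
  refine ⟨by simpa using hS, by simpa using hc, by simpa using hd, ?_⟩
  simp only [Finset.mem_map_equiv]
  intro v hv w hw
  exact hI _ hv _ (e.symm.map_adj_iff.2 hw)

theorem isIsolatingPair_pendantCliqueGraph (n : ℕ) :
    IsIsolatingPair (pendantCliqueGraph n) {Sum.inl 0} {Sum.inr (Sum.inr 0)} := by
  refine ⟨by simp, by simp, by simp, ?_⟩
  simp [pendantCliqueGraph, graphJoin]

theorem isIsolatingPair_halfSplitGraph {n : ℕ} (hn : 2 ≤ n) :
    IsIsolatingPair (halfSplitGraph n) (Finset.univ.map Function.Embedding.inl)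
      (Finset.univ.map Function.Embedding.inr) := by
  refine ⟨?_, by simp, ?_, ?_⟩
  · have : NeZero (n / 2) := ⟨by omega⟩
    simp
  · simp [Finset.disjoint_left]
  · simp [halfSplitGraph, graphJoin]

end Barriers

/-! ### Numerical bounds on spectral radii. -/

section Bounds

open scoped Classical Matrix

theorem sum_ite_eq_zero_else {m : ℕ} (i : Fin m) (a : ℝ) :
    ∑ j, (if i = j then 0 else a) = (m - 1) * a := by
  have : ∀ j, (if i = j then 0 else a) = a - if i = j then a else 0 := fun j => by
    split_ifs <;> simp
  simp only [this, Finset.sum_sub_distrib, Finset.sum_ite_eq, Finset.mem_univ, if_true,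
    Finset.sum_const, Finset.card_univ, Fintype.card_fin, nsmul_eq_mul]
  ring

theorem lt_adjSpectralRadius_pendantCliqueGraph {n : ℕ} (hn : 3 ≤ n) :
    (n : ℝ) - 2 < adjSpectralRadius (pendantCliqueGraph n) := by
  have h3 : (3 : ℝ) ≤ n := by exact_mod_cast hn
  have h2 : ((n - 2 : ℕ) : ℝ) = n - 2 := by rw [Nat.cast_sub (by omega)]; simp
  have hA : ∀ v, (((pendantCliqueGraph n).adjMatrix ℝ) *ᵥ
      (Sum.elim (fun _ => (n : ℝ) - 2) (Sum.elim (fun _ => (n : ℝ) - 2) fun _ => 1))) v =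
      Sum.elim (fun _ => ((n : ℝ) - 2) * (n - 2) + 1)
        (Sum.elim (fun _ => ((n : ℝ) - 2) * (n - 2)) fun _ => (n : ℝ) - 2) v := by
    intro v
    simp only [Matrix.mulVec, dotProduct, SimpleGraph.adjMatrix_apply, Fintype.sum_sum_type]
    rcases v with i | i | i
    · simp [pendantCliqueGraph, graphJoin, h2, Subsingleton.elim i 0]
      ring
    · simp [pendantCliqueGraph, graphJoin, sum_ite_eq_zero_else, h2]
      ring
    · simp [pendantCliqueGraph, graphJoin, Subsingleton.elim i 0]
  -- With value `n - 2` on the copy of `K_{n-1}` and `1` on the pendant vertex, every row is an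
  -- equality except the centre's, which gains `1`.
  refine lt_adjSpectralRadius_of_le_mulVec _
    (Sum.elim (fun _ => (n : ℝ) - 2) (Sum.elim (fun _ => (n : ℝ) - 2) fun _ => 1)) _ ?_ ?_
    (Sum.inl 0) ?_ ?_
  · rintro (i | i | i) <;> simp <;> linarith
  · intro v
    rw [hA]
    rcases v with i | i | i <;> simp
  · simp; linarith
  · rw [hA]; simp

theorem lt_adjSpectralRadius_halfSplitGraph {n : ℕ} (hn : 2 ≤ n) (a b r : ℝ) (ha : 0 < a)
    (hb : 0 ≤ b) (h1 : r * a < ((n / 2 : ℕ) - 1) * a + (n / 2 : ℕ) * b)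
    (h2 : r * b ≤ (n / 2 : ℕ) * a) : r < adjSpectralRadius (halfSplitGraph n) := by
  have hA : ∀ v, (((halfSplitGraph n).adjMatrix ℝ) *ᵥ
      (Sum.elim (fun _ => a) (fun _ => b))) v =
      Sum.elim (fun _ => ((n / 2 : ℕ) - 1) * a + (n / 2 : ℕ) * b) (fun _ => (n / 2 : ℕ) * a) v := by
    intro v
    simp only [Matrix.mulVec, dotProduct, SimpleGraph.adjMatrix_apply, Fintype.sum_sum_type]
    rcases v with i | i
    · simp [halfSplitGraph, graphJoin, sum_ite_eq_zero_else]
    · simp [halfSplitGraph, graphJoin]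
  refine lt_adjSpectralRadius_of_le_mulVec _
    (Sum.elim (fun _ => a) (fun _ => b)) _ ?_ ?_ (Sum.inl ⟨0, by omega⟩) ?_ ?_
  · rintro (i | i)
    exacts [ha.le, hb]
  · intro v
    rw [hA]
    rcases v with i | i
    exacts [h1.le, h2]
  · exact ha
  · rw [hA]; exact h1

variable {V : Type*} [Fintype V]

/-- The bound given by a positive vector constant on `S`, on `I` and on the remaining vertices. -/
theorem IsIsolatingPair.adjSpectralRadius_le {G : SimpleGraph V} {S I : Finset V}
    (h : IsIsolatingPair G S I) {t : ℕ} (ht : Fintype.card V = 2 * S.card + t) (a b c r : ℝ)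
    (ha : 0 < a) (hb : 0 < b) (hc : 0 < c)
    (h1 : S.card * a + t * b + S.card * c - a ≤ r * a)
    (h2 : S.card * a + t * b - b ≤ r * b)
    (h3 : S.card * a ≤ r * c) : adjSpectralRadius G ≤ r := by
  obtain ⟨hS, hcard, hdisj, hI⟩ := h
  have : Nonempty V := ⟨hS.choose⟩
  let z : V → ℝ := fun v => if v ∈ S then a else if v ∈ I then c else b
  have hzpos : ∀ v, 0 < z v := fun v => by simp only [z]; split_ifs <;> assumption
  have hzI : ∀ v ∈ I, z v = c := fun v hv => by
    simp only [z, if_neg (Finset.disjoint_right.1 hdisj hv), if_pos hv]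
  have hzS : ∀ v ∈ S, z v = a := fun v hv => if_pos hv
  have hsumS : ∑ v ∈ S, z v = S.card * a := by
    rw [Finset.sum_congr rfl hzS]; simp
  have hsumI : ∑ v ∈ I, z v = S.card * c := by
    rw [Finset.sum_congr rfl hzI]; simp [hcard]
  have hsumR : ∑ v ∈ (S ∪ I)ᶜ, z v = t * b := by
    have : ∀ v ∈ (S ∪ I)ᶜ, z v = b := fun v hv => by
      simp only [Finset.mem_compl, Finset.mem_union, not_or] at hv
      simp only [z, if_neg hv.1, if_neg hv.2]
    rw [Finset.sum_congr rfl this, Finset.sum_const, nsmul_eq_mul, Finset.card_compl,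
      Finset.card_union_of_disjoint hdisj, hcard, ht, ← two_mul, Nat.add_sub_cancel_left]
  have hsumIc : ∑ v ∈ Iᶜ, z v = S.card * a + t * b := by
    have : Iᶜ = S ∪ (S ∪ I)ᶜ := by
      ext v
      have : v ∈ S → v ∉ I := fun hv => Finset.disjoint_left.1 hdisj hv
      simp only [Finset.mem_compl, Finset.mem_union]
      tauto
    rw [this, Finset.sum_union, hsumS, hsumR]
    exact Finset.disjoint_left.2 fun v hv hv' =>
      Finset.mem_compl.1 hv' (Finset.mem_union_left _ hv)
  have hsum : ∑ v, z v = S.card * a + t * b + S.card * c := by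
    rw [← Finset.sum_compl_add_sum I, hsumIc, hsumI]
  refine adjSpectralRadius_le_of_mulVec_le G z r hzpos fun v => ?_
  rw [SimpleGraph.adjMatrix_mulVec_apply]
  have hle : ∀ T : Finset V, (∀ u, G.Adj v u → u ∈ T) →
      ∑ u ∈ G.neighborFinset v, z u ≤ ∑ u ∈ T, z u := fun T hT =>
    Finset.sum_le_sum_of_subset_of_nonneg
      (fun u hu => hT u (by simpa using hu)) fun i _ _ => (hzpos i).le
  by_cases hvS : v ∈ S
  · rw [hzS v hvS]
    have := hle (Finset.univ.erase v) fun u hu => by simp [hu.ne']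
    have h4 := Finset.sum_erase_add Finset.univ z (Finset.mem_univ v)
    rw [hzS v hvS] at h4
    linarith
  by_cases hvI : v ∈ I
  · rw [hzI v hvI]
    have := hle S (hI v hvI)
    linarith
  · have hzv : z v = b := by simp only [z, if_neg hvS, if_neg hvI]
    -- A neighbour of `v` in `I` would force `v ∈ S`.
    have := hle (Iᶜ.erase v) fun u hu => by
      simp only [Finset.mem_erase, Finset.mem_compl]
      exact ⟨hu.ne', fun huI => hvS (hI u huI v hu.symm)⟩
    have h4 := Finset.sum_erase_add Iᶜ z (Finset.mem_compl.2 hvI)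
    rw [hzv] at h4 ⊢
    linarith

theorem IsIsolatingPair.two_mul_card_le {G : SimpleGraph V} {S I : Finset V}
    (h : IsIsolatingPair G S I) : 2 * S.card ≤ Fintype.card V := by
  rw [two_mul]
  nth_rw 2 [← h.2.1]
  rw [← Finset.card_union_of_disjoint h.2.2.1]
  exact Finset.card_le_univ _

theorem IsIsolatingPair.adjSpectralRadius_le_card_sub_two {G : SimpleGraph V} {S I : Finset V}
    (h : IsIsolatingPair G S I) (hS : 2 ≤ S.card) (h4 : Fintype.card V ≠ 4)
    (h6 : Fintype.card V ≠ 6) : adjSpectralRadius G ≤ Fintype.card V - 2 := by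
  obtain ⟨t, ht⟩ := Nat.exists_eq_add_of_le h.two_mul_card_le
  -- The missing cases `t = 0`, `s = 2, 3` are exactly the orders `4` and `6`.
  have hst : 1 ≤ t ∨ 4 ≤ S.card ∧ t = 0 := by omega
  have hs : (2 : ℝ) ≤ S.card := by exact_mod_cast hS
  have ht0 : (0 : ℝ) ≤ t := t.cast_nonneg
  have hV : (Fintype.card V : ℝ) = 2 * S.card + t := by rw [ht]; push_cast; ring
  rw [hV]
  have key : (S.card : ℝ) ^ 2 * (2 * S.card - 1) ≤
      (2 * S.card + t - 2) * ((S.card - 1) * (2 * S.card - 1 + t)) := by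
    rcases hst with h1 | ⟨h1, rfl⟩
    · have h1' : (1 : ℝ) ≤ t := by exact_mod_cast h1
      have hx : (2 * S.card - 1 : ℝ) ≤ 2 * S.card + t - 2 := by linarith
      have hy : (S.card : ℝ) ^ 2 ≤ (S.card - 1) * (2 * S.card - 1 + t) := by nlinarith
      rw [mul_comm]
      exact mul_le_mul hx hy (by positivity) (by linarith)
    · have h1' : (4 : ℝ) ≤ S.card := by exact_mod_cast h1
      have hx : (S.card : ℝ) ^ 2 ≤ (2 * S.card - 2) * (S.card - 1) := by nlinarith
      have := mul_le_mul_of_nonneg_right hx (by linarith : (0 : ℝ) ≤ 2 * S.card - 1)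
      push_cast
      linarith
  -- For `r = n - 2` these weights make the conditions for `I` and for the remaining vertices
  -- equalities; the condition for `S` becomes `key`.
  refine h.adjSpectralRadius_le ht ((2 * S.card - 1) * (2 * S.card + t - 2))
    (S.card * (2 * S.card + t - 2)) (S.card * (2 * S.card - 1)) _ ?_ ?_ ?_ ?_ ?_ ?_
  · exact mul_pos (by linarith) (by linarith)
  · exact mul_pos (by linarith) (by linarith)
  · exact mul_pos (by linarith) (by linarith)
  · linarith
  · linarith
  · linarith

end Bounds

/-! ### Identification of the extremal graphs. -/

section Extremal

variable {V W : Type*} [Fintype V] [Fintype W]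

/-- Pulled back along the bijection `f`, `G` becomes a spanning subgraph of `H`, so strict
monotonicity applies. -/
theorem nonempty_iso_of_adjSpectralRadius_le {G : SimpleGraph V} (hG : G.Connected)
    {H : SimpleGraph W} (f : W → V) (hf : Function.Injective f)
    (hcard : Fintype.card W = Fintype.card V)
    (hadj : ∀ a b, G.Adj (f a) (f b) → H.Adj a b)
    (hρ : adjSpectralRadius H ≤ adjSpectralRadius G) : Nonempty (G ≃g H) := by
  let e : W ≃ V :=
    Equiv.ofBijective f ((Fintype.bijective_iff_injective_and_card f).2 ⟨hf, hcard⟩)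
  let i : G.comap e ≃g G := SimpleGraph.Iso.comap e G
  have h := eq_of_le_of_adjSpectralRadius_le (H := H) (i.connected_iff.2 hG)
    (fun a b hab => hadj a b hab) (by rwa [adjSpectralRadius_congr i])
  exact ⟨h ▸ i.symm⟩

theorem IsIsolatingPair.nonempty_iso_pendantCliqueGraph {G : SimpleGraph V} (hG : G.Connected)
    {S I : Finset V} (h : IsIsolatingPair G S I) (hS : S.card = 1)
    (hρ : adjSpectralRadius (pendantCliqueGraph (Fintype.card V)) ≤ adjSpectralRadius G) :
    Nonempty (G ≃g pendantCliqueGraph (Fintype.card V)) := by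
  classical
  have h2 := h.two_mul_card_le
  obtain ⟨-, hc, hd, hI⟩ := h
  obtain ⟨c, rfl⟩ := Finset.card_eq_one.1 hS
  obtain ⟨p, rfl⟩ := Finset.card_eq_one.1 (hc.trans hS)
  simp only [Finset.disjoint_singleton, Finset.mem_singleton, forall_eq] at hd hI
  have hcard : Fintype.card {v // v ∈ ({c, p} : Finset V)ᶜ} = Fintype.card V - 2 := by
    rw [Fintype.card_coe, Finset.card_compl, Finset.card_pair hd]
  let g := (Fintype.equivFinOfCardEq hcard).symm
  have hg : ∀ i, (g i : V) ≠ c ∧ (g i : V) ≠ p := fun i => by simpa using (g i).2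
  have hpg : ∀ i, ¬ G.Adj p (g i) := fun i hi => (hg i).1 (hI _ hi)
  refine nonempty_iso_of_adjSpectralRadius_le hG
    (Sum.elim (fun _ => c) (Sum.elim (fun i => (g i : V)) fun _ => p)) ?_ ?_ ?_ hρ
  · refine (Function.injective_of_subsingleton _).sumElim ((Subtype.val_injective.comp
      g.injective).sumElim (Function.injective_of_subsingleton _) fun i _ => (hg i).2) ?_
    rintro - (i | i)
    exacts [(hg i).1.symm, hd]
  · simp only [Fintype.card_sum, Fintype.card_fin]
    rw [Finset.card_singleton] at h2
    omega
  · rintro (i | i | i) (j | j | j) hij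
    · simp at hij
    · exact graphJoin_adj_inl_inr _ _ _ _
    · exact graphJoin_adj_inl_inr _ _ _ _
    · exact (graphJoin_adj_inl_inr _ _ _ _).symm
    · refine (graphJoin_adj_inr _ _ _ _).2 ?_
      change i ≠ j
      rintro rfl
      simp at hij
    · exact absurd hij.symm (hpg i)
    · exact (graphJoin_adj_inl_inr _ _ _ _).symm
    · exact absurd hij (hpg j)
    · simp at hij

theorem IsIsolatingPair.nonempty_iso_halfSplitGraph {G : SimpleGraph V} (hG : G.Connected)
    {S I : Finset V} (h : IsIsolatingPair G S I) (hS : 2 * S.card = Fintype.card V)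
    (hρ : adjSpectralRadius (halfSplitGraph (Fintype.card V)) ≤ adjSpectralRadius G) :
    Nonempty (G ≃g halfSplitGraph (Fintype.card V)) := by
  obtain ⟨-, hc, hd, hI⟩ := h
  have hSc : S.card = Fintype.card V / 2 := by omega
  let g := (S.equivFinOfCardEq hSc).symm
  let g' := (I.equivFinOfCardEq (hc.trans hSc)).symm
  refine nonempty_iso_of_adjSpectralRadius_le hG
    (Sum.elim (fun i => (g i : V)) (fun i => (g' i : V))) ?_ ?_ ?_ hρ
  · refine (Subtype.val_injective.comp g.injective).sumElim
      (Subtype.val_injective.comp g'.injective) fun i j hij => ?_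
    exact Finset.disjoint_left.1 hd (g i).2 (by
      have : (g i : V) = g' j := hij
      rw [this]; exact (g' j).2)
  · simp only [Fintype.card_sum, Fintype.card_fin]
    omega
  · rintro (i | i) (j | j) hij
    · refine (graphJoin_adj_inl _ _ _ _).2 ?_
      rw [SimpleGraph.top_adj]
      rintro rfl
      simp at hij
    · exact graphJoin_adj_inl_inr _ _ _ _
    · exact (graphJoin_adj_inl_inr _ _ _ _).symm
    · exact absurd (g' j).2 (Finset.disjoint_left.1 hd (hI _ (g' i).2 _ hij))

theorem exists_isIsolatingPair_iff_pendantCliqueGraph {G : SimpleGraph V} (hG : G.Connected)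
    {n : ℕ} (hV : Fintype.card V = n) (hn : 3 ≤ n) (h4 : n ≠ 4) (h6 : n ≠ 6)
    (hρ : adjSpectralRadius (pendantCliqueGraph n) ≤ adjSpectralRadius G) :
    (∃ S I : Finset V, IsIsolatingPair G S I) ↔ Nonempty (G ≃g pendantCliqueGraph n) := by
  constructor
  · rintro ⟨S, I, h⟩
    subst hV
    rcases (Nat.one_le_iff_ne_zero.2 (Finset.card_ne_zero.2 h.1)).eq_or_lt with hS | hS
    · exact h.nonempty_iso_pendantCliqueGraph hG hS.symm hρ
    · have := h.adjSpectralRadius_le_card_sub_two hS h4 h6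
      have := lt_adjSpectralRadius_pendantCliqueGraph hn
      linarith
  · rintro ⟨e⟩
    exact ⟨_, _, (isIsolatingPair_pendantCliqueGraph n).map e.symm⟩

theorem exists_isIsolatingPair_iff_halfSplitGraph {G : SimpleGraph V} (hG : G.Connected)
    {n : ℕ} (hV : Fintype.card V = n) (hn : n = 4 ∨ n = 6)
    (hρ : adjSpectralRadius (halfSplitGraph n) ≤ adjSpectralRadius G) :
    (∃ S I : Finset V, IsIsolatingPair G S I) ↔ Nonempty (G ≃g halfSplitGraph n) := by
  constructor
  · rintro ⟨S, I, h⟩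
    have h2 := h.two_mul_card_le
    have h0 : 0 < S.card := Finset.card_pos.2 h.1
    by_cases hS : 2 * S.card = n
    · subst hV
      exact h.nonempty_iso_halfSplitGraph hG hS hρ
    exfalso
    rcases hn with rfl | rfl
    · have hS1 : S.card = 1 := by omega
      -- `5/2` lies below `ρ(K_2 ∨ 2K_1) = (1 + √17)/2 ≈ 2.56`.
      have h5 := h.adjSpectralRadius_le (t := 2) (by omega) 1 (2 / 3) (2 / 5) (5 / 2)
        (by norm_num) (by norm_num) (by norm_num) (by rw [hS1]; norm_num) (by rw [hS1]; norm_num)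
        (by rw [hS1]; norm_num)
      have := lt_adjSpectralRadius_halfSplitGraph (n := 4) (by norm_num) 5 4 (5 / 2)
        (by norm_num) (by norm_num) (by norm_num) (by norm_num)
      linarith
    -- `41/10` lies below `ρ(K_3 ∨ 3K_1) = 1 + √10 ≈ 4.16` and bounds both remaining cases, `s = 1`
    -- and `s = 2`.
    · have := lt_adjSpectralRadius_halfSplitGraph (n := 6) (by norm_num) (7 / 5) 1 (41 / 10)
        (by norm_num) (by norm_num) (by norm_num) (by norm_num)
      have hS12 : S.card = 1 ∨ S.card = 2 := by omega
      rcases hS12 with hS1 | hS2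
      · have h5 := h.adjSpectralRadius_le (t := 4) (by omega) 1 (10 / 11) (1 / 4) (41 / 10)
          (by norm_num) (by norm_num) (by norm_num) (by rw [hS1]; norm_num)
          (by rw [hS1]; norm_num) (by rw [hS1]; norm_num)
        linarith
      · have h5 := h.adjSpectralRadius_le (t := 2) (by omega) 1 (20 / 31) (1 / 2) (41 / 10)
          (by norm_num) (by norm_num) (by norm_num) (by rw [hS2]; norm_num)
          (by rw [hS2]; norm_num) (by rw [hS2]; norm_num)
        linarith
  · rintro ⟨e⟩
    exact ⟨_, _, (isIsolatingPair_halfSplitGraph (by omega)).map e.symm⟩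

end Extremal

theorem theorem6p2 {V : Type*} [Fintype V] (G : SimpleGraph V) (hG : G.Connected)
    (n k : ℕ) (hV : Fintype.card V = n) (hn : 3 ≤ n) (hk : Even k) (hk2 : 2 ≤ k) :
    ((7 ≤ n ∨ n = 3 ∨ n = 5) →
      adjSpectralRadius (pendantCliqueGraph n) ≤ adjSpectralRadius G →
        (Odd n → (IsGFC k G ↔ ¬ Nonempty (G ≃g pendantCliqueGraph n))) ∧
        (Even n → (IsGBC k G ↔ ¬ Nonempty (G ≃g pendantCliqueGraph n)))) ∧
    ((n = 4 ∨ n = 6) →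
      adjSpectralRadius (halfSplitGraph n) ≤ adjSpectralRadius G →
        (IsGBC k G ↔ ¬ Nonempty (G ≃g halfSplitGraph n))) := by
  have : Nontrivial V := Fintype.one_lt_card_iff_nontrivial.1 (by omega)
  have hbar := forall_isKBarrier_iff_eq_empty hG hk (by omega)
  have hcard : Nat.card V = n := by rw [Nat.card_eq_fintype_card, hV]
  refine ⟨fun h hρ => ?_, fun h hρ => ?_⟩
  · have hiff := exists_isIsolatingPair_iff_pendantCliqueGraph hG hV hn (by omega) (by omega) hρ
    refine ⟨fun hodd => ?_, fun heven => ?_⟩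
    · rw [IsGFC, hcard, hbar, hiff]
      exact and_iff_right hodd
    · rw [IsGBC, hcard, hbar, hiff]
      exact and_iff_right heven
  · have hiff := exists_isIsolatingPair_iff_halfSplitGraph hG hV h hρ
    have heven : Even n := by rcases h with rfl | rfl <;> decide
    rw [IsGBC, hcard, hbar, hiff]
    exact and_iff_right heven
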